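/- Let $d \ge 2$ and let $B \subseteq \mathbb{R}^d$ be a finite set with $|B| > 1$. Then there is no Lebesgue measurable set $A \subseteq \mathbb{R}^d$ such that, for every orthogonal transformation $\rho \in O(d)$, $$\sum_{b \in B} \mathbf{1}_{\rho A}(x - b) = 1 \quad \text{for almost every } x \in \mathbb{R}^d,$$ where $\mathbf{1}_{\rho A}$ is the indicator function of $\rho A = \{\rho a : a \in A\}$ and "almost every" refers to Lebesgue measure on $\mathbb{R}^d$. -/

import Mathlib

section

open MeasureTheory Filter Topology

/-! Let `f` be the indicator of `A`. Moving the rotation from `A` to the differences `c` of `B`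
gives `f x + ∑ f (x + ρ c) = 1` a.e. for every `ρ`. Using this twice, with independent `ρ` and `ρ'`,
writes `f x` as a constant plus a double sum of `f (x + ρ c + ρ' c')`. Let `ρ`, `ρ'` run through
reflections attached to a plane. The planar part of `ρ c + ρ' c'` is a sum of points on two circles,
whose law, for suitably distributed angles, is absolutely continuous. Averaging therefore shows that
`f` is a.e. almost unchanged by small shifts in the plane; being 0-1 valued, it is exactly
unchanged. Hence `f` is a.e. constant, which no tiling by at least two translates allows. The weight
is carried by `exists_isProbabilityMeasure_forall_map_sum_circles_absolutelyContinuous` and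
`eventually_ae_eq_comp_add_smul_of_rotated_tiling`. -/

theorem exists_mem_nhds_forall_measure_inter_preimage_eq_zero
    {E : Type*} [NormedAddCommGroup E] [NormedSpace ℝ E] [FiniteDimensional ℝ E]
    [MeasurableSpace E] [BorelSpace E] (μ : Measure E) [μ.IsAddHaarMeasure]
    {Φ : E → E} (hΦ : ContDiff ℝ 1 Φ) {p : E} (hp : (fderiv ℝ Φ p).det ≠ 0) :
    ∃ U ∈ 𝓝 p, ∀ N : Set E, μ N = 0 → μ (U ∩ Φ ⁻¹' N) = 0 := by
  have hd : HasStrictFDerivAt Φ ((fderiv ℝ Φ p).toContinuousLinearEquivOfDetNeZero hp : E →L[ℝ] E)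
      p := by
    simpa using hΦ.contDiffAt.hasStrictFDerivAt one_ne_zero
  set e := hd.toOpenPartialHomeomorph Φ
  have hcont : Continuous fun x => (fderiv ℝ Φ x).det :=
    ContinuousLinearMap.continuous_det.comp (hΦ.continuous_fderiv one_ne_zero)
  set D : Set E := {x | (fderiv ℝ Φ x).det ≠ 0}
  have hD : IsOpen D := hcont.isOpen_preimage _ isOpen_ne
  have hU : IsOpen (e.source ∩ D) := e.open_source.inter hD
  refine ⟨e.source ∩ D, hU.mem_nhds ⟨hd.mem_toOpenPartialHomeomorph_source, hp⟩, fun N hN => ?_⟩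
  set S : Set E := (e.source ∩ D) ∩ Φ ⁻¹' toMeasurable μ N
  have hS : MeasurableSet S :=
    hU.measurableSet.inter (hΦ.continuous.measurable (measurableSet_toMeasurable μ N))
  have hinj : Set.InjOn Φ S := e.injOn.mono fun x hx => hx.1.1
  have key := lintegral_abs_det_fderiv_eq_addHaar_image μ hS
    (fun x _ => ((hΦ.differentiable one_ne_zero) x).hasFDerivAt.hasFDerivWithinAt) hinj
  have himg : μ (Φ '' S) = 0 := by
    refine measure_mono_null ?_ ((measure_toMeasurable N).trans hN)
    rintro _ ⟨x, hx, rfl⟩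
    exact hx.2
  rw [himg, setLIntegral_eq_zero_iff hS hcont.measurable.abs.ennreal_ofReal] at key
  refine measure_mono_null ?_ key
  rintro x ⟨hx, hxN⟩ h0
  have := h0 ⟨hx, subset_toMeasurable μ N hxN⟩
  simp only [ENNReal.ofReal_eq_zero] at this
  exact hx.2 (abs_nonpos_iff.1 this)

theorem tendsto_integral_abs_comp_sub_sub
    {F : Type*} [NormedAddCommGroup F] [NormedSpace ℝ F] [FiniteDimensional ℝ F]
    [MeasurableSpace F] [BorelSpace F] (μ : Measure F) [μ.IsAddHaarMeasure]
    {w : F → ℝ} (hw : Integrable w μ) :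
    Tendsto (fun h => ∫ y, |w (y - h) - w y| ∂μ) (𝓝 0) (𝓝 0) := by
  have hw1 : MemLp w 1 μ := memLp_one_iff_integrable.2 hw
  let T : C(F, C(F, F)) := (ContinuousMap.mk (fun q : F × F => q.2 - q.1) (by fun_prop)).curry
  have hT : ∀ h, MeasurePreserving (T h) μ μ := fun h => measurePreserving_sub_right μ h
  have hlim := (tendsto_const_nhds (x := hw1.toLp w) (f := 𝓝 (0 : F))).compMeasurePreservingLp
    (T.continuous.tendsto 0) hT (hT 0) ENNReal.one_ne_top
  have hlim' := tendsto_iff_norm_sub_tendsto_zero.1 hlim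
  refine hlim'.congr fun h => ?_
  rw [L1.norm_eq_integral_norm]
  refine integral_congr_ae ?_
  simp only [Lp.toLp_compMeasurePreserving]
  filter_upwards [Lp.coeFn_sub ((hw1.comp_measurePreserving (hT h)).toLp _)
      ((hw1.comp_measurePreserving (hT 0)).toLp _),
    (hw1.comp_measurePreserving (hT h)).coeFn_toLp,
    (hw1.comp_measurePreserving (hT 0)).coeFn_toLp] with y h1 h2 h3
  rw [h1, Pi.sub_apply, h2, h3, Real.norm_eq_abs]
  simp [T]

/-- Translation is continuous in L¹, applied to the density of `ν`. The bound is uniform in `g`, so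
one neighbourhood of shifts later serves every base point `x`. -/
theorem eventually_abs_integral_comp_add_sub_le
    {F : Type*} [NormedAddCommGroup F] [NormedSpace ℝ F] [FiniteDimensional ℝ F]
    [MeasurableSpace F] [BorelSpace F] (μ : Measure F) [μ.IsAddHaarMeasure]
    (ν : Measure F) [IsFiniteMeasure ν] (hν : ν ≪ μ) {ε : ℝ} (hε : 0 < ε) :
    ∀ᶠ h in 𝓝 (0 : F), ∀ g : F → ℝ, Measurable g → (∀ y, |g y| ≤ 1) →
      |∫ y, g (h + y) ∂ν - ∫ y, g y ∂ν| ≤ ε := by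
  set w : F → ℝ := fun y => (ν.rnDeriv μ y).toReal
  have hw : Integrable w μ := Measure.integrable_toReal_rnDeriv
  filter_upwards [(tendsto_integral_abs_comp_sub_sub μ hw).eventually (gt_mem_nhds hε)]
    with h hh g hg hb
  have hi : ∀ (w' : F → ℝ), Integrable w' μ → Integrable (fun y => w' y * g y) μ := fun w' hw' =>
    hw'.mul_bdd (c := 1) hg.aestronglyMeasurable (ae_of_all _ hb)
  have hwh : Integrable (fun y => w (y - h)) μ := hw.comp_sub_right h
  have e1 : ∫ y, g (h + y) ∂ν = ∫ y, w (y - h) * g y ∂μ := by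
    rw [← integral_rnDeriv_smul hν, ← integral_add_right_eq_self (fun y => w (y - h) * g y) h]
    simp [w, add_comm]
  have e2 : ∫ y, g y ∂ν = ∫ y, w y * g y ∂μ := by
    rw [← integral_rnDeriv_smul hν]; rfl
  rw [e1, e2, ← integral_sub (hi _ hwh) (hi _ hw)]
  refine (abs_integral_le_integral_abs).trans (le_trans ?_ hh.le)
  refine integral_mono ((hi _ hwh).sub (hi _ hw)).abs (hwh.sub hw).abs fun y => ?_
  simp only
  rw [← sub_mul, abs_mul]
  exact mul_le_of_le_one_right (abs_nonneg _) (hb y)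

/-! ### Sums of points on two circles -/

open Complex in
theorem exists_forall_im_mul_exp_ne_zero (S : Finset ℂ) (hS : ∀ w ∈ S, w ≠ 0) :
    ∃ φ : ℝ, ∀ w ∈ S, (w * exp (2 * φ * I)).im ≠ 0 := by
  -- Here `s = tan (2φ)`; when `w.re ≠ 0`, a vanishing imaginary part forces `s = -w.im / w.re`.
  obtain ⟨s, hs⟩ := Infinite.exists_notMem_finset (S.image fun w => -w.im / w.re)
  refine ⟨Real.arctan s / 2, fun w hw h0 => ?_⟩
  have he : (2 * ((Real.arctan s / 2 : ℝ) : ℂ) * I) = (Real.arctan s : ℝ) * I := by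
    push_cast; ring
  have hsin : Real.sin (Real.arctan s) = s * Real.cos (Real.arctan s) := by
    rw [Real.sin_arctan, Real.cos_arctan]; ring
  rw [he, mul_im, exp_ofReal_mul_I_re, exp_ofReal_mul_I_im, hsin] at h0
  have h1 : (w.re * s + w.im) * Real.cos (Real.arctan s) = 0 := by linarith
  have h2 := (mul_eq_zero.1 h1).resolve_right (Real.cos_arctan_pos s).ne'
  by_cases hre : w.re = 0
  · exact hS w hw (Complex.ext hre (by simpa [hre] using h2))
  · refine hs (Finset.mem_image.2 ⟨w, hw, ?_⟩)
    field_simp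
    linarith

-- At angles `(0, φ)` the partial derivatives are `2iz` and `2iz' exp (2iφ)`; the hypothesis says
-- that they are linearly independent over ℝ.
open Complex ComplexConjugate in
theorem det_fderiv_sum_circles_ne_zero {z z' : ℂ} (hz : z ≠ 0) {φ : ℝ}
    (h : (conj z * z' * exp (2 * φ * I)).im ≠ 0) :
    (fderiv ℝ (fun q : ℂ => z * exp (2 * q.re * I) + z' * exp (2 * q.im * I)) (φ * I)).det ≠ 0 := by
  have h1 : HasFDerivAt (fun q : ℂ => (q.re : ℂ)) (ofRealCLM.comp reCLM) (φ * I) :=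
    (ofRealCLM.comp reCLM).hasFDerivAt
  have h2 : HasFDerivAt (fun q : ℂ => (q.im : ℂ)) (ofRealCLM.comp imCLM) (φ * I) :=
    (ofRealCLM.comp imCLM).hasFDerivAt
  have hd := (((h1.const_mul 2).mul_const I).cexp.const_mul z).add
    (((h2.const_mul 2).mul_const I).cexp.const_mul z')
  have hfd := hd.fderiv
  intro hdet
  obtain ⟨v, hv, hv0⟩ := (Submodule.ne_bot_iff _).1
    (LinearMap.bot_lt_ker_of_det_eq_zero (f := (fderiv ℝ (fun q : ℂ => z * exp (2 * q.re * I) +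
      z' * exp (2 * q.im * I)) (φ * I)).toLinearMap) hdet).ne'
  have hv' : z * (v.re : ℂ) + z' * exp (2 * φ * I) * (v.im : ℂ) = 0 := by
    have hv2 : fderiv ℝ (fun q : ℂ => z * exp (2 * q.re * I) +
      z' * exp (2 * q.im * I)) (φ * I) v = 0 := hv
    erw [hfd] at hv2
    simp at hv2
    have h2I : (2 * I : ℂ) ≠ 0 := by simp
    refine mul_left_cancel₀ h2I ?_
    linear_combination hv2
  have hmul : (normSq z : ℂ) * (v.re : ℂ) + conj z * z' * exp (2 * φ * I) * (v.im : ℂ) = 0 := by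
    rw [normSq_eq_conj_mul_self]
    linear_combination conj z * hv'
  have him : v.im = 0 := by
    have := congrArg im hmul
    rw [← ofReal_mul, add_im, ofReal_im, im_mul_ofReal, zero_add, zero_im] at this
    exact (mul_eq_zero.1 this).resolve_left h
  have hre : v.re = 0 := by
    rw [him] at hv'
    simpa [hz] using hv'
  exact hv0 (Complex.ext hre him)

-- Normalised Lebesgue measure on a small ball about angles `(0, φ)`, with one `φ` good for all
-- pairs. A single `m` is needed because the whole double sum is averaged at once.
open Complex ComplexConjugate in
theorem exists_isProbabilityMeasure_forall_map_sum_circles_absolutelyContinuous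
    (S : Finset ℂ) (hS : ∀ z ∈ S, z ≠ 0) :
    ∃ m : Measure ℂ, IsProbabilityMeasure m ∧ ∀ z ∈ S, ∀ z' ∈ S,
      m.map (fun q : ℂ => z * exp (2 * q.re * I) + z' * exp (2 * q.im * I)) ≪ volume := by
  obtain ⟨φ, hφ⟩ := exists_forall_im_mul_exp_ne_zero
    ((S ×ˢ S).image fun q => conj q.1 * q.2) (by
      simp only [Finset.mem_image, Finset.mem_product, Prod.exists]
      rintro _ ⟨z, z', ⟨hz, hz'⟩, rfl⟩
      exact mul_ne_zero ((map_ne_zero _).2 (hS z hz)) (hS z' hz'))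
  have hsm : ∀ z z' : ℂ, ContDiff ℝ 1
      (fun q : ℂ => z * exp (2 * q.re * I) + z' * exp (2 * q.im * I)) := fun z z' => by
    have h1 : ContDiff ℝ 1 (fun q : ℂ => (q.re : ℂ)) := (ofRealCLM.comp reCLM).contDiff
    have h2 : ContDiff ℝ 1 (fun q : ℂ => (q.im : ℂ)) := (ofRealCLM.comp imCLM).contDiff
    fun_prop
  have hex : ∀ q ∈ S ×ˢ S, ∃ U ∈ 𝓝 (φ * I : ℂ), ∀ N : Set ℂ, volume N = 0 →
      volume (U ∩ (fun p : ℂ => q.1 * exp (2 * p.re * I) + q.2 * exp (2 * p.im * I)) ⁻¹' N) = 0 :=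
    fun q hq => exists_mem_nhds_forall_measure_inter_preimage_eq_zero volume (hsm q.1 q.2)
      (det_fderiv_sum_circles_ne_zero (hS _ (Finset.mem_product.1 hq).1)
        (hφ _ (Finset.mem_image_of_mem _ hq)))
  choose! U hU hUN using hex
  obtain ⟨r, hr, hball⟩ := Metric.mem_nhds_iff.1
    ((Filter.biInter_finset_mem (S ×ˢ S)).2 hU)
  refine ⟨ProbabilityTheory.cond volume (Metric.ball (φ * I : ℂ) r),
    ProbabilityTheory.cond_isProbabilityMeasure_of_finite (Metric.measure_ball_pos _ _ hr).ne'
      measure_ball_lt_top.ne,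
    fun z hz z' hz' => ?_⟩
  refine Measure.AbsolutelyContinuous.mk fun N hNm hN => ?_
  rw [Measure.map_apply (hsm z z').continuous.measurable hNm,
    ProbabilityTheory.cond_apply Metric.isOpen_ball.measurableSet]
  have hq : (z, z') ∈ S ×ˢ S := Finset.mk_mem_product hz hz'
  rw [measure_mono_null (Set.inter_subset_inter_left _
    (hball.trans (Set.biInter_subset_of_mem hq))) (hUN _ hq N hN), mul_zero]
-- Invariance under small shifts
-- Reflection fixing the line at angle `θ` in the plane of `u`, `v`: it negates the orthogonal
-- complement of the plane, and on the plane it is conjugation followed by rotation through `2θ`.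
open Complex ComplexConjugate InnerProductSpace in
theorem exists_linearIsometryEquiv_apply_eq
    {E : Type*} [NormedAddCommGroup E] [InnerProductSpace ℝ E] {u v : E}
    (hu : ‖u‖ = 1) (hv : ‖v‖ = 1) (huv : ⟪u, v⟫_ℝ = 0) (θ : ℝ) :
    ∃ ρ : E ≃ₗᵢ[ℝ] E, ∀ c : E, ρ c = (⟪u, c⟫_ℝ • u + ⟪v, c⟫_ℝ • v - c) +
      (((⟪u, c⟫_ℝ - ⟪v, c⟫_ℝ * I) * exp (2 * θ * I)).re • u +
       ((⟪u, c⟫_ℝ - ⟪v, c⟫_ℝ * I) * exp (2 * θ * I)).im • v) := by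
  set w : E := Real.cos θ • u + Real.sin θ • v with hw
  have hwn : ‖w‖ ^ 2 = 1 := by
    rw [hw, norm_add_sq_real, norm_smul, norm_smul, hu, hv, inner_smul_left, inner_smul_right, huv]
    simp
  refine ⟨(ℝ ∙ w).reflection, fun c => ?_⟩
  have he : exp (2 * θ * I) = (Real.cos (2 * θ) : ℂ) + (Real.sin (2 * θ) : ℂ) * I := by
    rw [ofReal_cos, ofReal_sin, ← exp_mul_I]; push_cast; rfl
  have hr : ((⟪u, c⟫_ℝ - ⟪v, c⟫_ℝ * I) * exp (2 * θ * I)).re =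
      ⟪u, c⟫_ℝ * Real.cos (2 * θ) + ⟪v, c⟫_ℝ * Real.sin (2 * θ) := by
    rw [he]; simp [-ofReal_cos, -ofReal_sin]
  have hi : ((⟪u, c⟫_ℝ - ⟪v, c⟫_ℝ * I) * exp (2 * θ * I)).im =
      ⟪u, c⟫_ℝ * Real.sin (2 * θ) - ⟪v, c⟫_ℝ * Real.cos (2 * θ) := by
    rw [he]; simp [-ofReal_cos, -ofReal_sin]; ring
  rw [hr, hi, Submodule.reflection_singleton_apply]
  simp only [RCLike.ofReal_real_eq_id, id_eq, hwn, div_one]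
  rw [hw, inner_add_left, real_inner_smul_left, real_inner_smul_left, Real.cos_two_mul,
    Real.sin_two_mul]
  have hsc := Real.sin_sq_add_cos_sq θ
  have h1 : Real.sin θ ^ 2 = 1 - Real.cos θ ^ 2 := by linarith
  match_scalars
  · ring
  · linear_combination (2 * ⟪v, c⟫_ℝ) * h1
  · ring

open Complex InnerProductSpace in
theorem eventually_ae_eq_comp_add_smul_of_rotated_tiling
    {E : Type*} [NormedAddCommGroup E] [InnerProductSpace ℝ E] [FiniteDimensional ℝ E]
    [MeasurableSpace E] [BorelSpace E] {μ : Measure E} [μ.IsAddHaarMeasure]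
    {ι : Type*} {C : Finset ι} {c : ι → E} {f : E → ℝ} (hfm : Measurable f)
    (hf : ∀ x, f x = 0 ∨ f x = 1)
    (htile : ∀ ρ : E ≃ₗᵢ[ℝ] E, ∀ᵐ x ∂μ, f x + ∑ i ∈ C, f (x + ρ (c i)) = 1)
    {u v : E} (hu : ‖u‖ = 1) (hv : ‖v‖ = 1) (huv : ⟪u, v⟫_ℝ = 0)
    (huc : ∀ i ∈ C, ⟪u, c i⟫_ℝ ≠ 0) :
    ∀ᶠ t in 𝓝 (0 : ℝ), ∀ᵐ x ∂μ, f (x + t • u) = f x := by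
  set z : ι → ℂ := fun i => ⟪u, c i⟫_ℝ - ⟪v, c i⟫_ℝ * I
  set a : ι → E := fun i => ⟪u, c i⟫_ℝ • u + ⟪v, c i⟫_ℝ • v - c i
  set L : ℂ → E := fun w => w.re • u + w.im • v
  have hLc : Continuous L := by fun_prop
  have hLadd : ∀ w w', L (w + w') = L w + L w' := fun w w' => by
    simp only [L, add_re, add_im]; module
  choose ρ hρ using exists_linearIsometryEquiv_apply_eq hu hv huv
  have hρ' : ∀ θ i, ρ θ (c i) = a i + L (z i * exp (2 * θ * I)) := fun θ i => hρ θ (c i)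
  set Φ : ι → ι → ℂ → ℂ := fun i j q => z i * exp (2 * q.re * I) + z j * exp (2 * q.im * I)
  have hΦc : ∀ i j, Continuous (Φ i j) := fun i j => by fun_prop
  obtain ⟨m, hm, hac⟩ := exists_isProbabilityMeasure_forall_map_sum_circles_absolutelyContinuous
    (C.image z) (by
      simp only [Finset.mem_image]
      rintro _ ⟨i, hi, rfl⟩ h0
      exact huc i hi (by simpa [z] using congrArg re h0))
  have hb : ∀ x, |f x| ≤ 1 := fun x => by rcases hf x with h | h <;> simp [h]
  -- The tiling identity at `x` for one angle, then at each `x + ρ (c i)` for the other.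
  have hstep : ∀ p : ℂ, ∀ᵐ x ∂μ,
      f x = 1 - C.card + ∑ i ∈ C, ∑ j ∈ C, f (x + (a i + a j) + L (Φ i j p)) := fun p => by
    have h2 : ∀ᵐ x ∂μ, ∀ i ∈ C, f (x + ρ p.re (c i)) +
        ∑ j ∈ C, f (x + ρ p.re (c i) + ρ p.im (c j)) = 1 :=
      (Finset.eventually_all C).2 fun i _ =>
        (measurePreserving_add_right μ (ρ p.re (c i))).quasiMeasurePreserving.ae (htile (ρ p.im))
    filter_upwards [htile (ρ p.re), h2] with x h1 h2
    have h3 : ∑ i ∈ C, f (x + ρ p.re (c i)) =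
        ∑ i ∈ C, (1 - ∑ j ∈ C, f (x + (a i + a j) + L (Φ i j p))) := by
      refine Finset.sum_congr rfl fun i hi => ?_
      have h4 : ∀ j, x + (a i + a j) + L (Φ i j p) = x + ρ p.re (c i) + ρ p.im (c j) := fun j => by
        rw [hρ', hρ', hLadd]; abel
      simp only [h4]
      linarith [h2 i hi]
    rw [h3, Finset.sum_sub_distrib, Finset.sum_const, nsmul_eq_mul, mul_one] at h1
    linarith
  have hmeas : ∀ i j, Measurable fun q : E × ℂ => f (q.1 + (a i + a j) + L (Φ i j q.2)) :=
    fun i j => hfm.comp (by fun_prop)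
  have hint : ∀ᵐ x ∂μ, f x = 1 - C.card +
      ∑ i ∈ C, ∑ j ∈ C, ∫ y, f (x + (a i + a j) + L y) ∂(m.map (Φ i j)) := by
    have hswap := (Measure.ae_ae_comm (μ := m) (ν := μ)
      (p := fun p x => f x = 1 - C.card + ∑ i ∈ C, ∑ j ∈ C, f (x + (a i + a j) + L (Φ i j p)))
      (measurableSet_eq_fun (hfm.comp measurable_snd) (measurable_const.add
        (Finset.measurable_sum _ fun i _ => Finset.measurable_sum _ fun j _ =>
          (hmeas i j).comp measurable_swap)))).1 (ae_of_all _ hstep)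
    filter_upwards [hswap] with x hx
    have hi : ∀ i j, Integrable (fun p => f (x + (a i + a j) + L (Φ i j p))) m := fun i j =>
      Integrable.of_bound (C := 1) ((hmeas i j).comp measurable_prodMk_left).aestronglyMeasurable
        (ae_of_all _ fun p => hb _)
    have hmap : ∀ i j, ∫ y, f (x + (a i + a j) + L y) ∂(m.map (Φ i j)) =
        ∫ p, f (x + (a i + a j) + L (Φ i j p)) ∂m := fun i j =>
      integral_map (hΦc i j).measurable.aemeasurable
        (hfm.comp (by fun_prop)).aestronglyMeasurable
    have hxi := integral_congr_ae hx
    simp only [hmap]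
    rw [integral_const, integral_add (integrable_const _) (integrable_finsetSum _ fun i _ =>
      integrable_finsetSum _ fun j _ => hi i j), integral_const,
      integral_finsetSum _ fun i _ => integrable_finsetSum _ fun j _ => hi i j] at hxi
    simp only [integral_finsetSum _ fun j _ => hi _ j] at hxi
    simpa using hxi
  -- Chosen so that the `C.card ^ 2` errors add up to less than 1, the gap between the values of
  -- `f`.
  set ε : ℝ := 1 / (C.card * C.card + 1)
  have hε : 0 < ε := by positivity
  have hsmooth : ∀ᶠ h in 𝓝 (0 : ℂ), ∀ i ∈ C, ∀ j ∈ C, ∀ g : ℂ → ℝ, Measurable g →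
      (∀ y, |g y| ≤ 1) →
      |∫ y, g (h + y) ∂(m.map (Φ i j)) - ∫ y, g y ∂(m.map (Φ i j))| ≤ ε := by
    refine (Finset.eventually_all C).2 fun i hi => (Finset.eventually_all C).2 fun j hj => ?_
    exact eventually_abs_integral_comp_add_sub_le volume _
      (hac _ (Finset.mem_image_of_mem z hi) _ (Finset.mem_image_of_mem z hj)) hε
  have hof : Tendsto (fun t : ℝ => (t : ℂ)) (𝓝 0) (𝓝 0) := by
    simpa using Complex.continuous_ofReal.tendsto 0
  filter_upwards [hof.eventually hsmooth] with t ht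
  filter_upwards [hint, (measurePreserving_add_right μ (t • u)).quasiMeasurePreserving.ae hint]
    with x h1 h2
  have hbound : ∀ i ∈ C, ∀ j ∈ C,
      |∫ y, f (x + t • u + (a i + a j) + L y) ∂(m.map (Φ i j)) -
        ∫ y, f (x + (a i + a j) + L y) ∂(m.map (Φ i j))| ≤ ε := fun i hi j hj => by
    convert ht i hi j hj (fun y => f (x + (a i + a j) + L y)) (hfm.comp (by fun_prop))
      (fun y => hb _) using 6 with y
    rw [hLadd]
    simp only [L, ofReal_re, ofReal_im, zero_smul, add_zero]
    abel_nf
  have hdiff : |f (x + t • u) - f x| < 1 := by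
    rw [h1, h2, add_sub_add_left_eq_sub, ← Finset.sum_sub_distrib]
    simp only [← Finset.sum_sub_distrib]
    calc _ ≤ ∑ i ∈ C, ∑ j ∈ C, ε :=
          (Finset.abs_sum_le_sum_abs _ _).trans (Finset.sum_le_sum fun i hi =>
            (Finset.abs_sum_le_sum_abs _ _).trans (Finset.sum_le_sum fun j hj => hbound i hi j hj))
      _ = (C.card * C.card) / (C.card * C.card + 1) := by
          simp only [Finset.sum_const, nsmul_eq_mul, ε]; ring
      _ < 1 := by rw [div_lt_one (by positivity)]; linarith
  rcases hf (x + t • u) with h | h <;> rcases hf x with h' | h' <;> rw [h, h'] at hdiff ⊢ <;>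
    norm_num at hdiff

/-! ### From small shifts to a constant function -/

theorem ae_eq_comp_add_of_eventually
    {E : Type*} [NormedAddCommGroup E] [NormedSpace ℝ E]
    [MeasurableSpace E] [BorelSpace E] {μ : Measure E} [μ.IsAddRightInvariant]
    {α : Type*} {f : E → α} {u : E}
    (h : ∀ᶠ t in 𝓝 (0 : ℝ), ∀ᵐ x ∂μ, f (x + t • u) = f x) (s : ℝ) :
    ∀ᵐ x ∂μ, f (x + s • u) = f x := by
  obtain ⟨n, hn, hn0⟩ := (((tendsto_const_div_atTop_nhds_zero_nat s).eventually h).and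
    (eventually_ne_atTop 0)).exists
  have key : ∀ k : ℕ, ∀ᵐ x ∂μ, f (x + (k * (s / n)) • u) = f x := fun k => by
    induction k with
    | zero => simp
    | succ k ih =>
      filter_upwards [ih, (measurePreserving_add_right μ
        ((k * (s / n)) • u)).quasiMeasurePreserving.ae hn] with x h1 h2
      rw [← h1, ← h2]
      congr 1
      push_cast
      module
  have := key n
  rwa [mul_div_cancel₀ _ (Nat.cast_ne_zero.2 hn0)] at this

open InnerProductSpace in
theorem exists_norm_eq_one_inner_eq_zero
    {E : Type*} [NormedAddCommGroup E] [InnerProductSpace ℝ E] [FiniteDimensional ℝ E]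
    (hE : 2 ≤ Module.finrank ℝ E) (u : E) : ∃ v : E, ‖v‖ = 1 ∧ ⟪u, v⟫_ℝ = 0 := by
  have h1 := Submodule.finrank_add_finrank_orthogonal (𝕜 := ℝ) (ℝ ∙ u)
  have h2 : Module.finrank ℝ (ℝ ∙ u) ≤ 1 := (finrank_span_le_card ({u} : Set E)).trans (by simp)
  have h3 : (ℝ ∙ u)ᗮ ≠ ⊥ := fun h => by
    rw [h, finrank_bot] at h1; omega
  obtain ⟨w, hw, hw0⟩ := (Submodule.ne_bot_iff _).1 h3
  refine ⟨‖w‖⁻¹ • w, norm_smul_inv_norm (𝕜 := ℝ) hw0, ?_⟩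
  rw [real_inner_smul_right, Submodule.mem_orthogonal_singleton_iff_inner_right.1 hw, mul_zero]

open InnerProductSpace in
theorem exists_ae_eq_const_of_rotated_tiling
    {E : Type*} [NormedAddCommGroup E] [InnerProductSpace ℝ E] [FiniteDimensional ℝ E]
    [MeasurableSpace E] [BorelSpace E] {μ : Measure E} [μ.IsAddHaarMeasure]
    (hE : 2 ≤ Module.finrank ℝ E)
    {ι : Type*} {C : Finset ι} {c : ι → E} (hc : ∀ i ∈ C, c i ≠ 0) {f : E → ℝ}
    (hfm : Measurable f) (hf : ∀ x, f x = 0 ∨ f x = 1)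
    (htile : ∀ ρ : E ≃ₗᵢ[ℝ] E, ∀ᵐ x ∂μ, f x + ∑ i ∈ C, f (x + ρ (c i)) = 1) :
    ∃ x₀, ∀ᵐ x ∂μ, f x = f x₀ := by
  have : Nontrivial E := Module.nontrivial_of_finrank_pos (R := ℝ) (by omega)
  have hgen : ∀ᵐ e ∂μ, ∀ i ∈ C, ⟪e, c i⟫_ℝ ≠ 0 := by
    refine (Finset.eventually_all C).2 fun i hi => ?_
    have hne : (ℝ ∙ c i)ᗮ ≠ ⊤ := fun h => hc i hi <| by
      simpa using h
    refine measure_mono_null (fun e he => ?_) (Measure.addHaar_submodule μ _ hne)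
    rw [SetLike.mem_coe, Submodule.mem_orthogonal_singleton_iff_inner_left]
    simpa using he
  have hper : ∀ᵐ e ∂μ, ∀ᵐ x ∂μ, f (x + e) = f x := by
    filter_upwards [hgen, Measure.ae_ne μ 0] with e he he0
    obtain ⟨v, hv, hev⟩ := exists_norm_eq_one_inner_eq_zero hE e
    have hu : ‖‖e‖⁻¹ • e‖ = 1 := norm_smul_inv_norm (𝕜 := ℝ) he0
    have := ae_eq_comp_add_of_eventually (eventually_ae_eq_comp_add_smul_of_rotated_tiling hfm hf
      htile hu hv (by rw [real_inner_smul_left, hev, mul_zero]) fun i hi => by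
        rw [real_inner_smul_left]
        exact mul_ne_zero (inv_ne_zero (norm_ne_zero_iff.2 he0)) (he i hi)) ‖e‖
    rwa [smul_inv_smul₀ (norm_ne_zero_iff.2 he0)] at this
  -- By Fubini, some single `x₀` satisfies `f (x₀ + e) = f x₀` for almost every `e`.
  rw [Measure.ae_ae_comm (p := fun e x => f (x + e) = f x) (measurableSet_eq_fun (hfm.comp (measurable_snd.add measurable_fst))
    (hfm.comp measurable_snd))] at hper
  obtain ⟨x₀, hx₀⟩ := hper.exists
  refine ⟨x₀, ?_⟩
  filter_upwards [(measurePreserving_sub_right μ x₀).quasiMeasurePreserving.ae hx₀] with x hx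
  simpa using hx

end

open MeasureTheory in
theorem mainTheorem1 (d : ℕ) (hd : 2 ≤ d) (B : Finset (EuclideanSpace ℝ (Fin d)))
    (hB : 1 < B.card) :
    ¬ ∃ A : Set (EuclideanSpace ℝ (Fin d)),
      MeasureTheory.NullMeasurableSet A MeasureTheory.volume ∧
      ∀ ρ : EuclideanSpace ℝ (Fin d) ≃ₗᵢ[ℝ] EuclideanSpace ℝ (Fin d),
        ∀ᵐ x ∂(MeasureTheory.volume : MeasureTheory.Measure (EuclideanSpace ℝ (Fin d))),
          ∑ b ∈ B, Set.indicator (ρ '' A) (fun _ => (1 : ℝ)) (x - b) = 1 := by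
  rintro ⟨A, hA, htile⟩
  obtain ⟨A', hA'm, hAA'⟩ := hA
  set f : EuclideanSpace ℝ (Fin d) → ℝ := A'.indicator fun _ => 1
  have hfA : f =ᵐ[volume] A.indicator fun _ => 1 := (indicator_ae_eq_of_ae_eq_set hAA').symm
  obtain ⟨b₀, hb₀⟩ : B.Nonempty := Finset.card_pos.1 (by omega)
  have htile' : ∀ ρ : EuclideanSpace ℝ (Fin d) ≃ₗᵢ[ℝ] EuclideanSpace ℝ (Fin d),
      ∀ᵐ x ∂volume, f x + ∑ b ∈ B.erase b₀, f (x + ρ (b₀ - b)) = 1 := fun ρ => by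
    -- The tiling for `ρ⁻¹` is read at `ρ⁻¹ x + b₀`, which turns rotated `A` into rotated
    -- differences `b₀ - b`.
    have h1 := ((measurePreserving_add_right volume b₀).comp
      ρ.symm.measurePreserving).quasiMeasurePreserving.ae (htile ρ.symm)
    have h2 : ∀ᵐ x ∂volume, ∀ b ∈ B, f (x + ρ (b₀ - b)) =
        A.indicator (fun _ => 1) (x + ρ (b₀ - b)) := (Finset.eventually_all B).2 fun b _ =>
      (measurePreserving_add_right volume (ρ (b₀ - b))).quasiMeasurePreserving.ae hfA
    filter_upwards [h1, h2] with x h1 h2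
    have h3 : f x + ∑ b ∈ B.erase b₀, f (x + ρ (b₀ - b)) = ∑ b ∈ B, f (x + ρ (b₀ - b)) := by
      rw [← Finset.add_sum_erase B _ hb₀, sub_self, map_zero, add_zero]
    rw [h3, ← h1]
    refine Finset.sum_congr rfl fun b hb => (h2 b hb).trans ?_
    have h4 : ρ.symm x + b₀ - b = ρ.symm (x + ρ (b₀ - b)) := by
      rw [map_add, ρ.symm_apply_apply, add_sub_assoc]
    simp only [Function.comp_apply, h4]
    exact (Set.indicator_image (g := ρ.symm) (f := fun _ => (1 : ℝ)) ρ.symm.injective).symm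
  have hf01 : ∀ x, f x = 0 ∨ f x = 1 := fun x => Set.indicator_eq_zero_or_self _ _ _
  obtain ⟨x₀, hx₀⟩ := exists_ae_eq_const_of_rotated_tiling (f := f) (by simpa using hd)
    (fun b hb => sub_ne_zero.2 (Finset.ne_of_mem_erase hb).symm)
    (measurable_const.indicator hA'm) hf01 htile'
  have hall : ∀ᵐ x ∂volume, ∀ b ∈ B.erase b₀, f (x + (b₀ - b)) = f x₀ :=
    (Finset.eventually_all _).2 fun b _ =>
      (measurePreserving_add_right volume (b₀ - b)).quasiMeasurePreserving.ae hx₀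
  obtain ⟨x, h1, h2, h3⟩ := (hx₀.and (hall.and
    (htile' (LinearIsometryEquiv.refl ℝ _)))).exists
  -- The constant value `k ∈ {0, 1}` would satisfy `B.card * k = 1` with `B.card ≥ 2`.
  simp only [LinearIsometryEquiv.coe_refl, id_eq] at h3
  rw [h1, Finset.sum_congr rfl h2, Finset.sum_const, nsmul_eq_mul,
    Finset.card_erase_of_mem hb₀] at h3
  have hcard : (1 : ℝ) ≤ (B.card - 1 : ℕ) := by exact_mod_cast (by omega : 1 ≤ B.card - 1)
  rcases hf01 x₀ with h | h <;> rw [h] at h3 <;> linarith
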